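/- Let $M$ be a smooth manifold of dimension $m\ge 3$. For a smooth Riemannian metric $g$ on $M$ with Levi-Civita connection $\nabla$ let $R(x,y)=\nabla_x\nabla_y-\nabla_y\nabla_x-\nabla_{[x,y]}$ be the curvature operator. With respect to a $g$-orthonormal frame $\{e_i\}$ let $\rho x=\sum_k R(x,e_k)e_k$ be the Ricci operator and $\tau=\sum_i g(\rho e_i,e_i)$ the scalar curvature. The Weyl conformal curvature operator $W=W_g$ is defined by $$R(x,y)=W(x,y)-\frac{\tau}{(m-1)(m-2)}R_0(x,y)+\frac1{m-2}L(x,y),$$ where $R_0(x,y)z=g(y,z)x-g(x,z)y$ and $L(x,y)z=g(\rho y,z)x-g(\rho x,z)y+g(y,z)\rho x-g(x,z)\rho y$. The conformal Jacobi operator of $x\in T_PM$ is the endomorphism $J_W(x)\colon y\mapsto W(y,x)x$ of $T_PM$. We say that $(M,g)$ is conformally Osserman if for every $P\in M$ the eigenvalues of $J_W(x)$, counted with multiplicity, are the same for all $x\in T_PM$ with $g(x,x)=1$ (they may depend on $P$). **Theorem 1.2.** Let $g_1$ and $g_2$ be conformally equivalent Riemannian metrics on $M$, that is, $g_1=\alpha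 g_2$ for a smooth function $\alpha\colon M\to(0,\infty)$. Then $(M,g_1)$ is conformally Osserman if and only if $(M,g_2)$ is conformally Osserman. -/

import Mathlib

open scoped Manifold ContDiff

set_option maxSynthPendingDepth 3

noncomputable section

namespace ConformalGeometry

/-! ### Riemannian geometry on a vector space

`G y` is a bilinear form on the vector space `E` depending on the point `y` of `E`: the components
of a metric in a chart. -/

section Local

variable {E : Type*} [NormedAddCommGroup E] [NormedSpace ℝ E]

/-- The right-hand side of the Koszul formula for constant vector fields:
`koszul G y u v w = D_u G (v, w) + D_v G (u, w) - D_w G (u, v)` at the point `y`. -/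
def koszul (G : E → E →L[ℝ] E →L[ℝ] ℝ) (y : E) : E →L[ℝ] E →L[ℝ] E →L[ℝ] ℝ :=
  fderiv ℝ G y + (fderiv ℝ G y).flip
    - (ContinuousLinearMap.flipₗᵢ ℝ E E ℝ).toContinuousLinearEquiv.toContinuousLinearMap ∘L
        (fderiv ℝ G y).flip

theorem koszul_apply (G : E → E →L[ℝ] E →L[ℝ] ℝ) (y u v w : E) :
    koszul G y u v w
      = fderiv ℝ G y u v w + fderiv ℝ G y v u w - fderiv ℝ G y w u v := by
  simp [koszul]

/-- The Christoffel symbols: `Γ (u, v)` is the vector with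
`2 G (Γ (u, v), w) = D_u G (v, w) + D_v G (u, w) - D_w G (u, v)` for all `w`. -/
def christoffel (G : E → E →L[ℝ] E →L[ℝ] ℝ) (y : E) : E →L[ℝ] E →L[ℝ] E :=
  (1 / 2 : ℝ) • (ContinuousLinearMap.compL ℝ E (E →L[ℝ] ℝ) E (G y).inverse) ∘L koszul G y

/-- The Levi-Civita connection `∇_X Y` in a chart. -/
def chartNabla (G : E → E →L[ℝ] E →L[ℝ] ℝ) (X Y : E → E) (y : E) : E :=
  fderiv ℝ Y y (X y) + christoffel G y (X y) (Y y)

/-- The curvature operator `R (u, v) w = ∇_u ∇_v w - ∇_v ∇_u w - ∇_[u, v] w` in a chart, in terms of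
the Christoffel symbols; see `chartCurvature_eq` for the agreement of the two expressions. -/
def chartCurvature (G : E → E →L[ℝ] E →L[ℝ] ℝ) (y u v : E) : E →L[ℝ] E :=
  fderiv ℝ (christoffel G) y u v - fderiv ℝ (christoffel G) y v u
    + christoffel G y u ∘L christoffel G y v - christoffel G y v ∘L christoffel G y u

theorem christoffel_apply (G : E → E →L[ℝ] E →L[ℝ] ℝ) (y u v : E) :
    christoffel G y u v = (1 / 2 : ℝ) • (G y).inverse (koszul G y u v) := by
  simp [christoffel]

theorem christoffel_spec (G : E → E →L[ℝ] E →L[ℝ] ℝ) (y : E) (h : (G y).IsInvertible)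
    (u v w : E) :
    2 * G y (christoffel G y u v) w
      = fderiv ℝ G y u v w + fderiv ℝ G y v u w - fderiv ℝ G y w u v := by
  rw [← koszul_apply, christoffel_apply]
  have : G y ((G y).inverse (koszul G y u v)) = koszul G y u v := by
    obtain ⟨e, he⟩ := h
    rw [← he]
    simp
  simp [this]

theorem chartCurvature_eq (G : E → E →L[ℝ] E →L[ℝ] ℝ) (y : E)
    (h : DifferentiableAt ℝ (christoffel G) y) (u v w : E) :
    chartCurvature G y u v w
      = chartNabla G (fun _ => u) (chartNabla G (fun _ => v) (fun _ => w)) y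
        - chartNabla G (fun _ => v) (chartNabla G (fun _ => u) (fun _ => w)) y
        - chartNabla G (VectorField.lieBracket ℝ (fun _ => u) (fun _ => v)) (fun _ => w) y := by
  have key : ∀ a b : E, chartNabla G (fun _ => a) (chartNabla G (fun _ => b) (fun _ => w)) y
      = fderiv ℝ (christoffel G) y a b w + christoffel G y a (christoffel G y b w) := by
    intro a b
    have h1 : HasFDerivAt (fun z => christoffel G z b w)
        (((fderiv ℝ (christoffel G) y).flip b).flip w) y := by
      have := (h.hasFDerivAt.clm_apply (hasFDerivAt_const b y)).clm_apply (hasFDerivAt_const w y)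
      convert this using 1
      ext; simp
    have h2 : chartNabla G (fun _ => b) (fun _ => w) = fun z => christoffel G z b w := by
      funext z; simp [chartNabla]
    rw [h2, chartNabla, h1.fderiv]
    simp
  rw [key, key]
  simp [chartCurvature, chartNabla, VectorField.lieBracket]
  abel

end Local

/-! ### Riemannian manifolds -/

section Manifold

variable {m : ℕ} {M : Type*} [TopologicalSpace M] [ChartedSpace (EuclideanSpace ℝ (Fin m)) M]
  [IsManifold (𝓡 m) ∞ M]

/-- A smooth Riemannian metric on the `m`-dimensional manifold `M`. -/
abbrev RiemMetric (m : ℕ) (M : Type*) [TopologicalSpace M]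
    [ChartedSpace (EuclideanSpace ℝ (Fin m)) M] [IsManifold (𝓡 m) ∞ M] :=
  Bundle.ContMDiffRiemannianMetric (𝓡 m) ∞ (EuclideanSpace ℝ (Fin m))
    (fun p : M => TangentSpace (𝓡 m) p)

/-- `g₁ = α g₂` for a smooth positive function `α`. -/
def ConformallyEquivalent (g₁ g₂ : RiemMetric m M) : Prop :=
  ∃ α : M → ℝ, ContMDiff (𝓡 m) 𝓘(ℝ, ℝ) ∞ α ∧ (∀ p, 0 < α p) ∧
    ∀ (p : M) (x y : TangentSpace (𝓡 m) p), g₁.inner p x y = α p * g₂.inner p x y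

/-- The components of the metric `g` in the preferred chart `φ` at `p`: the bilinear form
`(u, v) ↦ g (dφ⁻¹ u, dφ⁻¹ v)` at the point `φ⁻¹ y`. -/
def metricInChart (g : RiemMetric m M) (p : M) (y : EuclideanSpace ℝ (Fin m)) :
    EuclideanSpace ℝ (Fin m) →L[ℝ] EuclideanSpace ℝ (Fin m) →L[ℝ] ℝ :=
  (ContinuousLinearMap.precomp ℝ
      (mfderiv 𝓘(ℝ, EuclideanSpace ℝ (Fin m)) (𝓡 m) (extChartAt (𝓡 m) p).symm y)) ∘L
    (g.inner ((extChartAt (𝓡 m) p).symm y)) ∘L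
    (mfderiv 𝓘(ℝ, EuclideanSpace ℝ (Fin m)) (𝓡 m) (extChartAt (𝓡 m) p).symm y)

theorem metricInChart_apply (g : RiemMetric m M) (p : M) (y u v : EuclideanSpace ℝ (Fin m)) :
    metricInChart g p y u v = g.inner ((extChartAt (𝓡 m) p).symm y)
      (mfderiv 𝓘(ℝ, EuclideanSpace ℝ (Fin m)) (𝓡 m) (extChartAt (𝓡 m) p).symm y u)
      (mfderiv 𝓘(ℝ, EuclideanSpace ℝ (Fin m)) (𝓡 m) (extChartAt (𝓡 m) p).symm y v) := rfl

/-- The curvature operator `R (x, y) z` of `g` at `p`, computed in the preferred chart at `p`. -/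
def curvature (g : RiemMetric m M) (p : M) :
    TangentSpace (𝓡 m) p →ₗ[ℝ] TangentSpace (𝓡 m) p →ₗ[ℝ]
      TangentSpace (𝓡 m) p →ₗ[ℝ] TangentSpace (𝓡 m) p :=
  let φ := extChartAt (𝓡 m) p
  let E := EuclideanSpace ℝ (Fin m)
  let d : TangentSpace (𝓡 m) p →ₗ[ℝ] E := (mfderiv (𝓡 m) 𝓘(ℝ, E) φ p).toLinearMap
  let d' : E →ₗ[ℝ] TangentSpace (𝓡 m) p :=
    (mfderiv 𝓘(ℝ, E) (𝓡 m) φ.symm (φ p)).toLinearMap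
  LinearMap.mk₂ ℝ
    (fun x y => d' ∘ₗ (chartCurvature (metricInChart g p) (φ p) (d x) (d y)).toLinearMap ∘ₗ d)
    (fun x x' y => by ext z; simp [chartCurvature]; module)
    (fun c x y => by ext z; simp [chartCurvature]; module)
    (fun x y y' => by ext z; simp [chartCurvature]; module)
    (fun c x y => by ext z; simp [chartCurvature]; module)

/-- At every point there is a `g`-orthonormal frame. -/
theorem exists_orthonormalFrame (g : RiemMetric m M) (p : M) :
    ∃ e : Fin m → TangentSpace (𝓡 m) p, ∀ i j, g.inner p (e i) (e j) = if i = j then 1 else 0 := by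
  let _ : NormedAddCommGroup (TangentSpace (𝓡 m) p) :=
    (g.toRiemannianMetric.toCore p).toNormedAddCommGroup
  let _ : InnerProductSpace ℝ (TangentSpace (𝓡 m) p) :=
    InnerProductSpace.ofCore (g.toRiemannianMetric.toCore p).toCore
  have : FiniteDimensional ℝ (TangentSpace (𝓡 m) p) :=
    inferInstanceAs (FiniteDimensional ℝ (EuclideanSpace ℝ (Fin m)))
  have hd : Module.finrank ℝ (TangentSpace (𝓡 m) p) = m :=
    finrank_euclideanSpace_fin (𝕜 := ℝ) (n := m)
  let b := (stdOrthonormalBasis ℝ (TangentSpace (𝓡 m) p)).reindex (finCongr hd)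
  exact ⟨b, fun i j => orthonormal_iff_ite.1 b.orthonormal i j⟩

/-- A `g`-orthonormal frame of the tangent space at `p`. -/
def orthonormalFrame (g : RiemMetric m M) (p : M) : Fin m → TangentSpace (𝓡 m) p :=
  (exists_orthonormalFrame g p).choose

/-- The Ricci operator `ρ x = ∑ k, R (x, e k) (e k)`, that is, `ρ (e i) = ∑ j, ρ_ij e_j` with
`ρ_ij = ∑ k, R_ikkj`. It does not depend on the orthonormal frame. -/
def ricci (g : RiemMetric m M) (p : M) : TangentSpace (𝓡 m) p →ₗ[ℝ] TangentSpace (𝓡 m) p :=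
  ∑ k, ((curvature g p).flip (orthonormalFrame g p k)).flip (orthonormalFrame g p k)

/-- The scalar curvature `τ = ∑ i, ρ_ii`. -/
def scalarCurvature (g : RiemMetric m M) (p : M) : ℝ :=
  ∑ i, g.inner p (ricci g p (orthonormalFrame g p i)) (orthonormalFrame g p i)

/-- `R₀ (x, y) z = g (y, z) x - g (x, z) y`. -/
def tensorR0 (g : RiemMetric m M) (p : M) (x y z : TangentSpace (𝓡 m) p) :
    TangentSpace (𝓡 m) p :=
  g.inner p y z • x - g.inner p x z • y

/-- `L (x, y) z = g (ρ y, z) x - g (ρ x, z) y + g (y, z) ρ x - g (x, z) ρ y`. -/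
def tensorL (g : RiemMetric m M) (p : M) (x y z : TangentSpace (𝓡 m) p) :
    TangentSpace (𝓡 m) p :=
  g.inner p (ricci g p y) z • x - g.inner p (ricci g p x) z • y
    + g.inner p y z • ricci g p x - g.inner p x z • ricci g p y

/-- The Weyl conformal curvature operator, `W = R - c₁ τ R₀ - c₂ L` with
`c₁ = -1 / ((m - 1) (m - 2))` and `c₂ = 1 / (m - 2)`, in dimension `m ≥ 3`. -/
def weyl (g : RiemMetric m M) (p : M) (x y z : TangentSpace (𝓡 m) p) : TangentSpace (𝓡 m) p :=
  curvature g p x y z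
    - (-1 / (((m : ℝ) - 1) * ((m : ℝ) - 2)) * scalarCurvature g p) • tensorR0 g p x y z
    - (1 / ((m : ℝ) - 2)) • tensorL g p x y z

/-- The conformal Jacobi operator `J_W (x) : y ↦ W (y, x) x`. -/
def conformalJacobi (g : RiemMetric m M) (p : M) (x : TangentSpace (𝓡 m) p) :
    Module.End ℝ (TangentSpace (𝓡 m) p) where
  toFun y := weyl g p y x x
  map_add' y y' := by
    simp only [weyl, tensorR0, tensorL, map_add, LinearMap.add_apply, add_apply]
    module
  map_smul' c y := by
    simp only [weyl, tensorR0, tensorL, map_smul, LinearMap.smul_apply,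
      smul_apply, RingHom.id_apply, smul_eq_mul]
    module

/-- `(M, g)` is conformally Osserman: at each point `p` the eigenvalues of `J_W (x)`, with their
multiplicities, are the same for all unit tangent vectors `x` at `p`. -/
def IsConformallyOsserman (g : RiemMetric m M) : Prop :=
  ∀ (p : M) (x y : TangentSpace (𝓡 m) p), g.inner p x x = 1 → g.inner p y y = 1 →
    ∀ c : ℝ, Module.finrank ℝ ((conformalJacobi g p x).eigenspace c)
      = Module.finrank ℝ ((conformalJacobi g p y).eigenspace c)

end Manifold
end ConformalGeometry

end

noncomputable section

namespace ConformalGeometry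

/-! ### Conformal change of connection and curvature in a chart. -/

section ConformalChange

variable {E : Type*} [NormedAddCommGroup E] [NormedSpace ℝ E]

/-! The Weyl operator, as a (1,3)-tensor, is a conformal invariant. Write `g₁ = exp (2 f) g₂` and
let `N` be the gradient of `f`. The Christoffel symbols change by terms in `df` and `N`, and the
curvature changes by an expression of the shape of `L` with an endomorphism `A` in place of `ρ`
(`chartCurvature_conformal`). Contracting gives `α ρ₁ = ρ₂ + (m - 2) A + (tr A) id` and `α τ₁ = τ₂ +
2 (m - 1) tr A`. With these, the changes of the three terms of `W` cancel (`weyl_eq_of_curvature`).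

Hence both metrics have the same `J_W`, which is quadratic in `x`. Passing from `g₂`-unit to
`g₁`-unit vectors at `p` multiplies every eigenvalue by `1 / α p`, a factor independent of the
direction, so constancy of the spectrum is preserved. -/

theorem hasFDerivAt_clm_apply₂ {F : Type*} [NormedAddCommGroup F] [NormedSpace ℝ F]
    {B : E → E →L[ℝ] E →L[ℝ] F} {y : E} (hd : DifferentiableAt ℝ B y) (b c : E) :
    HasFDerivAt (fun z => B z b c) (((fderiv ℝ B y).flip b).flip c) y := by
  have := (hd.hasFDerivAt.clm_apply (hasFDerivAt_const b y)).clm_apply (hasFDerivAt_const c y)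
  refine this.congr_fderiv ?_
  ext; simp

/-- Symmetry is differentiated, so it is assumed near `y` and not only at `y`. -/
theorem fderiv_apply_comm {F : Type*} [NormedAddCommGroup F] [NormedSpace ℝ F]
    {B : E → E →L[ℝ] E →L[ℝ] F} {y : E} (hd : DifferentiableAt ℝ B y)
    (hs : ∀ᶠ z in nhds y, ∀ u v, B z u v = B z v u) (a b c : E) :
    fderiv ℝ B y a b c = fderiv ℝ B y a c b := by
  have h' := (hasFDerivAt_clm_apply₂ hd c b).congr_of_eventuallyEq (hs.mono fun z hz => hz b c)
  simpa using congr($((hasFDerivAt_clm_apply₂ hd b c).unique h') a)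

theorem christoffel_symm {G : E → E →L[ℝ] E →L[ℝ] ℝ} {y : E} (hd : DifferentiableAt ℝ G y)
    (hs : ∀ᶠ z in nhds y, ∀ u v, G z u v = G z v u) (u v : E) :
    christoffel G y u v = christoffel G y v u := by
  have hk : koszul G y u v = koszul G y v u := by
    ext w
    rw [koszul_apply, koszul_apply, fderiv_apply_comm hd hs w u v]
    ring
  rw [christoffel_apply, christoffel_apply, hk]

/-- The Levi-Civita connection is metric. -/
theorem fderiv_metric_apply {G : E → E →L[ℝ] E →L[ℝ] ℝ} {y : E} (hd : DifferentiableAt ℝ G y)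
    (hs : ∀ᶠ z in nhds y, ∀ u v, G z u v = G z v u) (hi : (G y).IsInvertible) (u v w : E) :
    fderiv ℝ G y u v w = G y (christoffel G y u v) w + G y v (christoffel G y u w) := by
  -- In the sum of the Koszul identities for `(u, v, w)` and `(u, w, v)` only `2 D_u G (v, w)`
  -- survives.
  have h1 := christoffel_spec G y hi u v w
  have h2 := christoffel_spec G y hi u w v
  rw [hs.self_of_nhds v (christoffel G y u w)]
  have key := fderiv_apply_comm hd hs
  rw [key u w v, key v u w, key w u v] at h2
  rw [key w u v, key v u w] at h1
  linarith

/-- The gradient of `f` with respect to the metric `G`. -/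
def gradient (G : E → E →L[ℝ] E →L[ℝ] ℝ) (f : E → ℝ) (y : E) : E :=
  (G y).inverse (fderiv ℝ f y)

theorem metric_gradient {G : E → E →L[ℝ] E →L[ℝ] ℝ} {y : E} (hi : (G y).IsInvertible)
    (f : E → ℝ) : G y (gradient G f y) = fderiv ℝ f y := by
  unfold gradient
  obtain ⟨e, he⟩ := hi
  simp [← he]

/-- The Christoffel symbols of `exp (2 f) G`. -/
theorem christoffel_conformal {G : E → E →L[ℝ] E →L[ℝ] ℝ} {f : E → ℝ} {y : E}
    (hG : DifferentiableAt ℝ G y) (hf : DifferentiableAt ℝ f y)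
    (hi : (G y).IsInvertible) (u v : E) :
    christoffel (fun z => Real.exp (2 * f z) • G z) y u v
      = christoffel G y u v + fderiv ℝ f y u • v + fderiv ℝ f y v • u
        - G y u v • gradient G f y := by
  set a := Real.exp (2 * f y) with ha
  have ha0 : a ≠ 0 := (Real.exp_pos _).ne'
  have hd : HasFDerivAt (fun z => Real.exp (2 * f z) • G z)
      (a • fderiv ℝ G y + (a • (2 : ℝ) • fderiv ℝ f y).smulRight (G y)) y :=
    ((hf.hasFDerivAt.const_mul 2).exp).smul hG.hasFDerivAt
  have hi' : (a • G y).IsInvertible := by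
    obtain ⟨e, he⟩ := hi
    refine ⟨e.trans (ContinuousLinearEquiv.smulLeft (Units.mk0 a ha0)), ?_⟩
    ext; simp [← he]
  have hinj : Function.Injective (a • G y) := by
    obtain ⟨e, he⟩ := hi'
    rw [← he]; exact e.injective
  -- By nondegeneracy the formula may be tested against `a G`. The two Koszul identities then differ
  -- by the factor `a` and by the derivative `2 a df` of the conformal factor.
  apply hinj
  ext w
  have h1 := christoffel_spec (fun z => Real.exp (2 * f z) • G z) y hi' u v w
  have h2 := christoffel_spec G y hi u v w
  rw [hd.fderiv] at h1
  simp only [add_apply, smul_apply, ContinuousLinearMap.smulRight_apply, smul_eq_mul, map_add,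
    map_sub, map_smul, sub_apply, metric_gradient hi] at h1 ⊢
  linear_combination (1 / 2) * h1 - (a / 2) * h2

theorem differentiableAt_inverse [CompleteSpace E] {G : E → E →L[ℝ] E →L[ℝ] ℝ} {y : E}
    (hG : DifferentiableAt ℝ G y) (hi : (G y).IsInvertible) :
    DifferentiableAt ℝ (fun z => (G z).inverse) y := by
  obtain ⟨e, he⟩ := hi
  have h := (contDiffAt_map_inverse (𝕜 := ℝ) (n := 1) e).differentiableAt (by simp)
  rw [he] at h
  exact h.comp y hG

theorem differentiableAt_gradient [CompleteSpace E] {G : E → E →L[ℝ] E →L[ℝ] ℝ} {f : E → ℝ}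
    {y : E} (hG : DifferentiableAt ℝ G y) (hi : (G y).IsInvertible)
    (hf : DifferentiableAt ℝ (fderiv ℝ f) y) : DifferentiableAt ℝ (gradient G f) y :=
  (differentiableAt_inverse hG hi).clm_apply hf

theorem differentiableAt_koszul {G : E → E →L[ℝ] E →L[ℝ] ℝ} {y : E} (hG : ContDiffAt ℝ 2 G y) :
    DifferentiableAt ℝ (koszul G) y := by
  have h1 : DifferentiableAt ℝ (fderiv ℝ G) y :=
    (hG.fderiv_right (m := 1) (by norm_num)).differentiableAt (by simp)
  have h2 : DifferentiableAt ℝ (fun z => (fderiv ℝ G z).flip) y :=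
    (ContinuousLinearMap.flipₗᵢ ℝ E E (E →L[ℝ] ℝ)).differentiable.differentiableAt.comp y h1
  have h3 : DifferentiableAt ℝ
      (fun z => (ContinuousLinearMap.flipₗᵢ ℝ E E ℝ).toContinuousLinearEquiv.toContinuousLinearMap
        ∘L (fderiv ℝ G z).flip) y :=
    (ContinuousLinearMap.compL ℝ E (E →L[ℝ] E →L[ℝ] ℝ) (E →L[ℝ] E →L[ℝ] ℝ)
      (ContinuousLinearMap.flipₗᵢ ℝ E E ℝ).toContinuousLinearEquiv.toContinuousLinearMap
      ).differentiableAt.comp y h2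
  exact (h1.add h2).sub h3

theorem differentiableAt_christoffel [CompleteSpace E] {G : E → E →L[ℝ] E →L[ℝ] ℝ} {y : E}
    (hG : ContDiffAt ℝ 2 G y) (hi : (G y).IsInvertible) :
    DifferentiableAt ℝ (christoffel G) y := by
  have hI := differentiableAt_inverse (hG.differentiableAt (by simp)) hi
  have hk := differentiableAt_koszul hG
  have h1 : DifferentiableAt ℝ
      (fun z => ContinuousLinearMap.compL ℝ E (E →L[ℝ] ℝ) E (G z).inverse) y :=
    (ContinuousLinearMap.compL ℝ E (E →L[ℝ] ℝ) E).differentiableAt.comp y hI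
  have h2 : DifferentiableAt ℝ
      (fun z => (ContinuousLinearMap.compL ℝ E (E →L[ℝ] ℝ) E (G z).inverse) ∘L koszul G z) y :=
    h1.clm_comp hk
  exact h2.const_smul (1 / 2 : ℝ)

/-- The endomorphism `u ↦ df (u) N - ∇_u N - |N|² / 2 u` with `N` the gradient of `f`, which
governs the change of the curvature from `G` to `exp (2 f) G`. -/
def schoutenChange (G : E → E →L[ℝ] E →L[ℝ] ℝ) (f : E → ℝ) (y : E) : E →ₗ[ℝ] E :=
  ((fderiv ℝ f y).smulRight (gradient G f y) - fderiv ℝ (gradient G f) y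
    - (christoffel G y).flip (gradient G f y)
    - (fderiv ℝ f y (gradient G f y) / 2) • ContinuousLinearMap.id ℝ E).toLinearMap

/-- The curvature of `exp (2 f) G`. -/
theorem chartCurvature_conformal [CompleteSpace E] {G : E → E →L[ℝ] E →L[ℝ] ℝ} {f : E → ℝ} {y : E}
    (hG : ContDiffAt ℝ 2 G y) (hf : ContDiffAt ℝ 2 f y)
    (hi : ∀ᶠ z in nhds y, (G z).IsInvertible) (hs : ∀ᶠ z in nhds y, ∀ u v, G z u v = G z v u)
    (u v w : E) :
    chartCurvature (fun z => Real.exp (2 * f z) • G z) y u v w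
      = chartCurvature G y u v w
        + (G y (schoutenChange G f y v) w • u - G y (schoutenChange G f y u) w • v
          + G y v w • schoutenChange G f y u - G y u w • schoutenChange G f y v) := by
  have hiy := hi.self_of_nhds
  have hsy := hs.self_of_nhds
  have hdG : DifferentiableAt ℝ G y := hG.differentiableAt (by simp)
  have hdf : DifferentiableAt ℝ f y := hf.differentiableAt (by simp)
  have hddf : DifferentiableAt ℝ (fderiv ℝ f) y :=
    (hf.fderiv_right (m := 1) (by norm_num)).differentiableAt (by simp)
  have hN := differentiableAt_gradient hdG hiy hddf
  have hC := differentiableAt_christoffel hG hiy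
  have hG1 : ContDiffAt ℝ 2 (fun z => Real.exp (2 * f z) • G z) y :=
    ((contDiffAt_const.mul hf).exp).smul hG
  have hiy1 : (Real.exp (2 * f y) • G y).IsInvertible := by
    obtain ⟨e, he⟩ := hiy
    refine ⟨e.trans (ContinuousLinearEquiv.smulLeft (Units.mk0 _ (Real.exp_pos (2 * f y)).ne')), ?_⟩
    ext; simp [← he]
  have hC1 := differentiableAt_christoffel hG1 hiy1
  -- The curvature differentiates the Christoffel symbols, so their formula is needed on a
  -- neighbourhood.
  have hev : ∀ᶠ z in nhds y, ∀ b c, christoffel (fun z => Real.exp (2 * f z) • G z) z b c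
      = christoffel G z b c + fderiv ℝ f z b • c + fderiv ℝ f z c • b
        - G z b c • gradient G f z := by
    filter_upwards [hi, hG.eventually (by simp), hf.eventually (by simp)] with z h1 h2 h3 b c
    exact christoffel_conformal (h2.differentiableAt (by simp)) (h3.differentiableAt (by simp))
      h1 b c
  have hdΓ : ∀ a b c, fderiv ℝ (christoffel (fun z => Real.exp (2 * f z) • G z)) y a b c
      = fderiv ℝ (christoffel G) y a b c + fderiv ℝ (fderiv ℝ f) y a b • c
        + fderiv ℝ (fderiv ℝ f) y a c • b
        - (fderiv ℝ G y a b c • gradient G f y + G y b c • fderiv ℝ (gradient G f) y a) := by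
    intro a b c
    have hθ (b : E) : HasFDerivAt (fun z => fderiv ℝ f z b) ((fderiv ℝ (fderiv ℝ f) y).flip b) y :=
      (hddf.hasFDerivAt.clm_apply (hasFDerivAt_const b y)).congr_fderiv (by ext; simp)
    have h1 := (((hasFDerivAt_clm_apply₂ hC b c).add ((hθ b).smul_const c)).add
      ((hθ c).smul_const b)).sub ((hasFDerivAt_clm_apply₂ hdG b c).smul hN.hasFDerivAt)
    have h2 := (hasFDerivAt_clm_apply₂ hC1 b c).congr_of_eventuallyEq
      (hev.mono fun z hz => (hz b c).symm)
    have := congr($(h2.unique h1) a)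
    simp at this
    rw [this]
    abel
  -- This makes the terms `D²f (u, v) w` drop out of the antisymmetrization in `u` and `v`.
  have hsymm : fderiv ℝ (fderiv ℝ f) y u v = fderiv ℝ (fderiv ℝ f) y v u :=
    (hf.isSymmSndFDerivAt (by simp)).eq u v
  have hΓ := hev.self_of_nhds
  have hmet := fderiv_metric_apply hdG hs hiy
  have hchr := christoffel_symm hdG hs
  have hNG := metric_gradient hiy f
  -- Differentiating `G (N, ·) = df` trades second derivatives of `f` for the derivative of `N` that
  -- occurs in `schoutenChange`.
  have hhess : ∀ a b, fderiv ℝ (fderiv ℝ f) y a b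
      = G y (fderiv ℝ (gradient G f) y a) b + G y (christoffel G y a (gradient G f y)) b
        + fderiv ℝ f y (christoffel G y a b) := by
    intro a b
    have h1 : HasFDerivAt (fun z => G z (gradient G f z)) _ y :=
      hdG.hasFDerivAt.clm_apply hN.hasFDerivAt
    have h2 := h1.congr_of_eventuallyEq (f₁ := fderiv ℝ f)
      (hi.mono fun z hz => (metric_gradient hz f).symm)
    have := congr($(h2.fderiv) a b)
    simp at this
    rw [this, hmet, hNG]
    ring
  simp only [chartCurvature, add_apply, sub_apply, ContinuousLinearMap.comp_apply, hdΓ, hΓ,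
    schoutenChange, ContinuousLinearMap.coe_coe, ContinuousLinearMap.smulRight_apply, smul_apply,
    ContinuousLinearMap.flip_apply, ContinuousLinearMap.id_apply, map_add, map_sub, map_smul,
    smul_eq_mul]
  have hN' : ∀ a, G y a (gradient G f y) = fderiv ℝ f y a := fun a => by rw [hsy, hNG]
  rw [hsymm]
  simp only [hhess, hmet, hNG, hN', hchr v u, hsy v u, hsy (christoffel G y u v)]
  simp only [hsy _ (christoffel G y _ _)]
  match_scalars <;> ring

end ConformalChange

/-! ### Orthonormal frames and traces. -/

section Frame

variable {V W : Type*} [AddCommGroup V] [Module ℝ V] [AddCommGroup W] [Module ℝ W] {m : ℕ}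

/-- Orthonormality forces linear independence, and `m` independent vectors form a basis; pairing
with `e i` reads off the coefficients. -/
theorem sum_smul_frame [FiniteDimensional ℝ V] (hV : Module.finrank ℝ V = m) (b : V →ₗ[ℝ] V →ₗ[ℝ] ℝ)
    {e : Fin m → V} (he : ∀ i j, b (e i) (e j) = if i = j then 1 else 0) (x : V) :
    ∑ k, b x (e k) • e k = x := by
  have hli : LinearIndependent ℝ e := by
    rw [Fintype.linearIndependent_iff]
    intro c hc i
    simpa [he] using congr(b $hc (e i))
  have hspan := hli.span_eq_top_of_card_eq_finrank' (by simp [hV])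
  have hx : x ∈ Submodule.span ℝ (Set.range e) := hspan ▸ Submodule.mem_top
  obtain ⟨c, rfl⟩ := (Submodule.mem_span_range_iff_exists_fun ℝ).1 hx
  simp [he]

/-- Comparison of traces with respect to orthonormal frames of homothetic inner products. -/
theorem sum_frame_apply_eq [FiniteDimensional ℝ V] (hV : Module.finrank ℝ V = m)
    (b : V →ₗ[ℝ] V →ₗ[ℝ] ℝ) (c : ℝ) {e e' : Fin m → V}
    (he : ∀ i j, b (e i) (e j) = if i = j then 1 else 0)
    (he' : ∀ i j, c * b (e' i) (e' j) = if i = j then 1 else 0)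
    (hb : ∀ x y, b x y = b y x) (B : V →ₗ[ℝ] V →ₗ[ℝ] W) :
    ∑ k, B (e k) (e k) = c • ∑ k, B (e' k) (e' k) := by
  have h1 : ∀ k, B (e' k) (e' k) = ∑ i, ∑ j, (b (e' k) (e i) * b (e' k) (e j)) • B (e i) (e j) := by
    intro k
    conv_lhs => rw [← sum_smul_frame hV b he (e' k)]
    simp only [map_sum, map_smul, LinearMap.sum_apply, LinearMap.smul_apply, Finset.smul_sum,
      smul_smul]
    rw [Finset.sum_comm]
    exact Finset.sum_congr rfl fun i _ => Finset.sum_congr rfl fun j _ => by rw [mul_comm]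
  -- The transition matrix `P k i = b (e' k) (e i)` satisfies `c Pᵀ P = 1`: expand `e i` in the
  -- frame `e'`, orthonormal for `c • b`.
  have h2 : ∀ i j, ∑ k, c * (b (e' k) (e i) * b (e' k) (e j)) = if i = j then 1 else 0 := by
    intro i j
    rw [← he]
    conv_rhs => rw [← sum_smul_frame hV (c • b) he' (e i)]
    simp [hb (e i), mul_assoc]
  symm
  simp_rw [h1]
  rw [Finset.sum_comm, Finset.smul_sum]
  refine Finset.sum_congr rfl fun i _ => ?_
  rw [Finset.sum_comm, Finset.smul_sum, Finset.sum_eq_single i]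
  · rw [← Finset.sum_smul, smul_smul, Finset.mul_sum, h2, if_pos rfl, one_smul]
  · intro j _ hj
    rw [← Finset.sum_smul, smul_smul, Finset.mul_sum, h2, if_neg hj.symm, zero_smul]
  · simp

end Frame

/-! ### Frames on the manifold. -/

section Manifold

variable {m : ℕ} {M : Type*} [TopologicalSpace M] [ChartedSpace (EuclideanSpace ℝ (Fin m)) M]
  [IsManifold (𝓡 m) ∞ M]

theorem inner_orthonormalFrame (g : RiemMetric m M) (p : M) (i j : Fin m) :
    g.inner p (orthonormalFrame g p i) (orthonormalFrame g p j) = if i = j then 1 else 0 :=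
  (exists_orthonormalFrame g p).choose_spec i j

/-- The frames of `g₁` and `g₂` are unrelated choices; this moves every contraction for `g₁` to the
frame of `g₂`. -/
theorem sum_orthonormalFrame_conformal {g₁ g₂ : RiemMetric m M} {p : M} {a : ℝ}
    (h : ∀ x y, g₁.inner p x y = a * g₂.inner p x y) {W : Type*} [AddCommGroup W] [Module ℝ W]
    (B : TangentSpace (𝓡 m) p →ₗ[ℝ] TangentSpace (𝓡 m) p →ₗ[ℝ] W) :
    ∑ k, B (orthonormalFrame g₂ p k) (orthonormalFrame g₂ p k)
      = a • ∑ k, B (orthonormalFrame g₁ p k) (orthonormalFrame g₁ p k) := by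
  have : FiniteDimensional ℝ (TangentSpace (𝓡 m) p) :=
    inferInstanceAs (FiniteDimensional ℝ (EuclideanSpace ℝ (Fin m)))
  have hd : Module.finrank ℝ (TangentSpace (𝓡 m) p) = m :=
    finrank_euclideanSpace_fin (𝕜 := ℝ) (n := m)
  exact sum_frame_apply_eq hd (g₂.inner p).toLinearMap₁₂ a (inner_orthonormalFrame g₂ p)
    (fun i j => (h _ _).symm.trans (inner_orthonormalFrame g₁ p i j)) (g₂.symm p) B

theorem sum_inner_smul_orthonormalFrame (g : RiemMetric m M) (p : M)
    (x : TangentSpace (𝓡 m) p) :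
    ∑ k, g.inner p x (orthonormalFrame g p k) • orthonormalFrame g p k = x := by
  have : FiniteDimensional ℝ (TangentSpace (𝓡 m) p) :=
    inferInstanceAs (FiniteDimensional ℝ (EuclideanSpace ℝ (Fin m)))
  have hd : Module.finrank ℝ (TangentSpace (𝓡 m) p) = m :=
    finrank_euclideanSpace_fin (𝕜 := ℝ) (n := m)
  exact sum_smul_frame hd (g.inner p).toLinearMap₁₂ (inner_orthonormalFrame g p) x

theorem ricci_apply (g : RiemMetric m M) (p : M) (x : TangentSpace (𝓡 m) p) :
    ricci g p x = ∑ k, curvature g p x (orthonormalFrame g p k) (orthonormalFrame g p k) := by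
  simp [ricci]

/-! ### Ricci, scalar and Weyl curvature under the change. -/

section Pointwise

variable {g₁ g₂ : RiemMetric m M} {p : M} {a : ℝ}
  {A : TangentSpace (𝓡 m) p →ₗ[ℝ] TangentSpace (𝓡 m) p}

/-- Setting `y = z = e k` and summing, the four terms give `(tr A) x`, `-A x`, `m A x` and `-A x`.
No self-adjointness of `A` is needed. -/
theorem ricci_conformal (h : ∀ x y, g₁.inner p x y = a * g₂.inner p x y)
    (hA : ∀ x y z, curvature g₁ p x y z = curvature g₂ p x y z
      + (g₂.inner p (A y) z • x - g₂.inner p (A x) z • y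
        + g₂.inner p y z • A x - g₂.inner p x z • A y)) (x : TangentSpace (𝓡 m) p) :
    a • ricci g₁ p x = ricci g₂ p x + ((m : ℝ) - 2) • A x
      + (∑ k, g₂.inner p (A (orthonormalFrame g₂ p k)) (orthonormalFrame g₂ p k)) • x := by
  rw [ricci_apply g₁, ← sum_orthonormalFrame_conformal h (curvature g₁ p x), ricci_apply g₂]
  have h1 := sum_inner_smul_orthonormalFrame g₂ p (A x)
  have h2 := congr(A $(sum_inner_smul_orthonormalFrame g₂ p x))
  simp only [map_sum, map_smul] at h2
  simp only [hA, Finset.sum_add_distrib, Finset.sum_sub_distrib, h1, h2, inner_orthonormalFrame,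
    if_true, ← Finset.sum_smul]
  simp
  module

theorem scalarCurvature_conformal (h : ∀ x y, g₁.inner p x y = a * g₂.inner p x y)
    (hA : ∀ x y z, curvature g₁ p x y z = curvature g₂ p x y z
      + (g₂.inner p (A y) z • x - g₂.inner p (A x) z • y
        + g₂.inner p y z • A x - g₂.inner p x z • A y)) :
    a * scalarCurvature g₁ p = scalarCurvature g₂ p + 2 * ((m : ℝ) - 1)
      * ∑ k, g₂.inner p (A (orthonormalFrame g₂ p k)) (orthonormalFrame g₂ p k) := by
  have key : ∑ k, g₁.inner p (ricci g₁ p (orthonormalFrame g₂ p k)) (orthonormalFrame g₂ p k)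
      = a • ∑ k, g₁.inner p (ricci g₁ p (orthonormalFrame g₁ p k)) (orthonormalFrame g₁ p k) :=
    sum_orthonormalFrame_conformal h ((g₁.inner p).toLinearMap₁₂ ∘ₗ ricci g₁ p)
  rw [scalarCurvature, ← smul_eq_mul, ← key]
  have h1 : ∀ x y, g₁.inner p (ricci g₁ p x) y = g₂.inner p (a • ricci g₁ p x) y := by
    intro x y; simp [h]
  simp only [h1, ricci_conformal h hA, map_add, map_smul, add_apply, smul_apply, smul_eq_mul,
    Finset.sum_add_distrib, inner_orthonormalFrame, if_true, ← Finset.mul_sum]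
  simp [scalarCurvature]
  ring

/-- Both `R₀` and the metric factors in `L` scale by `a`, exactly what `a ρ₁` and `a τ₁` absorb.
Then `L` changes by `m - 2` times the change of `R` plus `2 t R₀`, and the `τ` term cancels this
`R₀` part. -/
theorem weyl_eq_of_curvature (hm : 3 ≤ m) (h : ∀ x y, g₁.inner p x y = a * g₂.inner p x y)
    (hA : ∀ x y z, curvature g₁ p x y z = curvature g₂ p x y z
      + (g₂.inner p (A y) z • x - g₂.inner p (A x) z • y
        + g₂.inner p y z • A x - g₂.inner p x z • A y)) (x y z : TangentSpace (𝓡 m) p) :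
    weyl g₁ p x y z = weyl g₂ p x y z := by
  have hm' : (3 : ℝ) ≤ m := by exact_mod_cast hm
  have hm1 : (m : ℝ) - 1 ≠ 0 := by linarith
  have hm2 : (m : ℝ) - 2 ≠ 0 := by linarith
  set t := ∑ k, g₂.inner p (A (orthonormalFrame g₂ p k)) (orthonormalFrame g₂ p k) with ht
  have hτ := scalarCurvature_conformal h hA
  have hρ := ricci_conformal h hA
  rw [← ht] at hτ
  simp only [← ht] at hρ
  have hR : scalarCurvature g₁ p • tensorR0 g₁ p x y z
      = (scalarCurvature g₂ p + 2 * ((m : ℝ) - 1) * t) • tensorR0 g₂ p x y z := by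
    rw [← hτ]
    simp only [tensorR0, h]
    module
  have h1 : ∀ x y, g₁.inner p (ricci g₁ p x) y = g₂.inner p (a • ricci g₁ p x) y := by
    intro x y; simp [h]
  have hL : tensorL g₁ p x y z = g₂.inner p (a • ricci g₁ p y) z • x
      - g₂.inner p (a • ricci g₁ p x) z • y + g₂.inner p y z • a • ricci g₁ p x
      - g₂.inner p x z • a • ricci g₁ p y := by
    simp only [tensorL, h1]
    simp only [h]
    module
  rw [weyl, weyl, mul_smul, mul_smul, hR, hL, hA]
  simp only [tensorR0, tensorL, hρ, map_add, map_smul, add_apply, smul_apply, smul_eq_mul]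
  match_scalars <;> field_simp <;> ring

end Pointwise

/-! ### Regularity and nondegeneracy of the metric in a chart. -/

theorem mfderiv_extChartAt_symm_apply_apply (p : M) (x : TangentSpace (𝓡 m) p) :
    mfderiv 𝓘(ℝ, EuclideanSpace ℝ (Fin m)) (𝓡 m) (extChartAt (𝓡 m) p).symm (extChartAt (𝓡 m) p p)
      (mfderiv (𝓡 m) 𝓘(ℝ, EuclideanSpace ℝ (Fin m)) (extChartAt (𝓡 m) p) p x) = x := by
  have : IsManifold (𝓡 m) 1 M := .of_le (n := ∞) (by simp)
  have h := mfderivWithin_extChartAt_symm_comp_mfderiv_extChartAt' (I := 𝓡 m)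
    (mem_extChartAt_source (I := 𝓡 m) p)
  rw [ModelWithCorners.Boundaryless.range_eq_univ, mfderivWithin_univ] at h
  exact congr($h x)

theorem metricInChart_self (g : RiemMetric m M) (p : M) (u v : EuclideanSpace ℝ (Fin m)) :
    metricInChart g p (extChartAt (𝓡 m) p p) u v = g.inner p
      (mfderiv 𝓘(ℝ, EuclideanSpace ℝ (Fin m)) (𝓡 m) (extChartAt (𝓡 m) p).symm
        (extChartAt (𝓡 m) p p) u)
      (mfderiv 𝓘(ℝ, EuclideanSpace ℝ (Fin m)) (𝓡 m) (extChartAt (𝓡 m) p).symm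
        (extChartAt (𝓡 m) p p) v) := by
  -- The base points `φ⁻¹ (φ p)` and `p` are equal only propositionally, so the forms are compared
  -- on the common model space.
  have key : ∀ q, q = p → ∀ a b : EuclideanSpace ℝ (Fin m),
      (g.inner q : EuclideanSpace ℝ (Fin m) →L[ℝ] EuclideanSpace ℝ (Fin m) →L[ℝ] ℝ) a b
        = (g.inner p : EuclideanSpace ℝ (Fin m) →L[ℝ] EuclideanSpace ℝ (Fin m) →L[ℝ] ℝ) a b := by
    rintro _ rfl _ _; rfl
  exact key _ (extChartAt_to_inv p) _ _

/-- Positive definiteness gives injectivity, and `E` and its dual have equal finite dimension. -/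
theorem metricInChart_isInvertible (g : RiemMetric m M) (p : M) {y : EuclideanSpace ℝ (Fin m)}
    (hy : y ∈ (extChartAt (𝓡 m) p).target) : (metricInChart g p y).IsInvertible := by
  have : IsManifold (𝓡 m) 1 M := .of_le (n := ∞) (by simp)
  have hinv := isInvertible_mfderivWithin_extChartAt_symm hy
  rw [ModelWithCorners.Boundaryless.range_eq_univ, mfderivWithin_univ] at hinv
  have hinj : Function.Injective
      (mfderiv 𝓘(ℝ, EuclideanSpace ℝ (Fin m)) (𝓡 m) (extChartAt (𝓡 m) p).symm y) := by
    obtain ⟨e, he⟩ := hinv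
    rw [← he]; exact e.injective
  have hG : Function.Injective (metricInChart g p y).toLinearMap := by
    rw [injective_iff_map_eq_zero]
    intro u hu
    by_contra hne
    have hpos := g.pos ((extChartAt (𝓡 m) p).symm y)
      (mfderiv 𝓘(ℝ, EuclideanSpace ℝ (Fin m)) (𝓡 m) (extChartAt (𝓡 m) p).symm y u)
      (fun h0 => hne (hinj (h0.trans (map_zero _).symm)))
    rw [← metricInChart_apply] at hpos
    have : metricInChart g p y u u = 0 := congr($hu u)
    linarith
  have hfr : Module.finrank ℝ (EuclideanSpace ℝ (Fin m))
      = Module.finrank ℝ (EuclideanSpace ℝ (Fin m) →L[ℝ] ℝ) :=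
    (InnerProductSpace.toDual ℝ (EuclideanSpace ℝ (Fin m))).toLinearEquiv.finrank_eq
  refine ⟨(LinearMap.linearEquivOfInjective _ hG hfr).toContinuousLinearEquiv, ?_⟩
  ext; rfl

/-- In finite dimension it suffices to test on constant `u` and `v`. The tangent map of `φ⁻¹`
carries them to smooth fields along `φ⁻¹`, on which `g` is evaluated smoothly. -/
theorem contDiffOn_metricInChart (g : RiemMetric m M) (p : M) :
    ContDiffOn ℝ ∞ (metricInChart g p) (extChartAt (𝓡 m) p).target := by
  have : IsManifold (𝓡 m) 1 M := .of_le (n := ∞) (by simp)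
  have hopen := isOpen_extChartAt_target (I := 𝓡 m) p
  have hsymm := contMDiffOn_extChartAt_symm (I := 𝓡 m) (n := ∞) p
  have htan := hsymm.contMDiffOn_tangentMapWithin (m := ∞) (by simp) hopen.uniqueMDiffOn
  have hsec : ∀ u : EuclideanSpace ℝ (Fin m), ContMDiffOn 𝓘(ℝ, EuclideanSpace ℝ (Fin m))
      ((𝓡 m).prod 𝓘(ℝ, EuclideanSpace ℝ (Fin m))) ∞
      (fun y => Bundle.TotalSpace.mk' (EuclideanSpace ℝ (Fin m))
        (E := fun q : M => TangentSpace (𝓡 m) q) ((extChartAt (𝓡 m) p).symm y)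
        (mfderiv 𝓘(ℝ, EuclideanSpace ℝ (Fin m)) (𝓡 m) (extChartAt (𝓡 m) p).symm y u))
      (extChartAt (𝓡 m) p).target := by
    intro u
    have hu : ContMDiffOn 𝓘(ℝ, EuclideanSpace ℝ (Fin m))
        (𝓘(ℝ, EuclideanSpace ℝ (Fin m)).prod 𝓘(ℝ, EuclideanSpace ℝ (Fin m))) ∞
        (fun y => (Bundle.TotalSpace.mk' (EuclideanSpace ℝ (Fin m)) y u :
          TangentBundle 𝓘(ℝ, EuclideanSpace ℝ (Fin m)) (EuclideanSpace ℝ (Fin m))))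
        (extChartAt (𝓡 m) p).target := fun y _ =>
      contMDiffWithinAt_vectorSpace_iff_contDiffWithinAt.2 contDiffWithinAt_const
    refine (htan.comp hu (fun y hy => hy)).congr fun y hy => ?_
    simp only [Function.comp_apply, tangentMapWithin, mfderivWithin_of_isOpen hopen hy]
  rw [contDiffOn_clm_apply]
  intro u
  rw [contDiffOn_clm_apply]
  intro v y hy
  have key := ContMDiffWithinAt.clm_bundle_apply₂ (F₁ := EuclideanSpace ℝ (Fin m))
    (F₂ := EuclideanSpace ℝ (Fin m)) (F₃ := ℝ) (E₃ := Bundle.Trivial M ℝ)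
    (g.contMDiff.contMDiffAt.comp_contMDiffWithinAt y (hsymm y hy)) (hsec u y hy) (hsec v y hy)
  rw [Bundle.contMDiffWithinAt_totalSpace] at key
  exact key.2.contDiffWithinAt

/-- The conformal change of the curvature operator. -/
theorem exists_curvature_eq {g₁ g₂ : RiemMetric m M} {α : M → ℝ}
    (hα : ContMDiff (𝓡 m) 𝓘(ℝ, ℝ) ∞ α) (hpos : ∀ p, 0 < α p)
    (h : ∀ (p : M) (x y : TangentSpace (𝓡 m) p), g₁.inner p x y = α p * g₂.inner p x y) (p : M) :
    ∃ A : TangentSpace (𝓡 m) p →ₗ[ℝ] TangentSpace (𝓡 m) p, ∀ x y z,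
      curvature g₁ p x y z = curvature g₂ p x y z
        + (g₂.inner p (A y) z • x - g₂.inner p (A x) z • y
          + g₂.inner p y z • A x - g₂.inner p x z • A y) := by
  have htgt := extChartAt_target_mem_nhds (I := 𝓡 m) p
  -- Chosen so that `exp (2 f) = α ∘ φ⁻¹`; as `α` is positive everywhere, this holds even off the
  -- chart target.
  set f : EuclideanSpace ℝ (Fin m) → ℝ :=
    fun y => Real.log (α ((extChartAt (𝓡 m) p).symm y)) / 2 with hf
  have hexp : metricInChart g₁ p = fun y => Real.exp (2 * f y) • metricInChart g₂ p y := by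
    funext y
    ext u v
    have : Real.exp (2 * f y) = α ((extChartAt (𝓡 m) p).symm y) := by
      rw [hf, mul_div_cancel₀ _ (two_ne_zero), Real.exp_log (hpos _)]
    rw [this, smul_apply, smul_apply, metricInChart_apply, metricInChart_apply, h, smul_eq_mul]
  have hfd : ContDiffAt ℝ 2 f (extChartAt (𝓡 m) p p) := by
    have h1 : ContDiffAt ℝ ∞ (fun y => α ((extChartAt (𝓡 m) p).symm y)) (extChartAt (𝓡 m) p p) :=
      ((hα.comp_contMDiffOn (contMDiffOn_extChartAt_symm (I := 𝓡 m) (n := ∞) p)).contMDiffAt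
        htgt).contDiffAt
    exact ((h1.log (hpos _).ne').div_const 2).of_le (WithTop.coe_le_coe.2 le_top)
  have hG : ContDiffAt ℝ 2 (metricInChart g₂ p) (extChartAt (𝓡 m) p p) :=
    ((contDiffOn_metricInChart g₂ p).contDiffAt htgt).of_le (WithTop.coe_le_coe.2 le_top)
  have key := chartCurvature_conformal hG hfd
    (Filter.mem_of_superset htgt fun y hy => metricInChart_isInvertible g₂ p hy)
    (Filter.Eventually.of_forall fun y u v => g₂.symm _ _ _)
  let d : TangentSpace (𝓡 m) p →ₗ[ℝ] EuclideanSpace ℝ (Fin m) :=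
    (mfderiv (𝓡 m) 𝓘(ℝ, EuclideanSpace ℝ (Fin m)) (extChartAt (𝓡 m) p) p).toLinearMap
  let d' : EuclideanSpace ℝ (Fin m) →ₗ[ℝ] TangentSpace (𝓡 m) p :=
    (mfderiv 𝓘(ℝ, EuclideanSpace ℝ (Fin m)) (𝓡 m) (extChartAt (𝓡 m) p).symm
      (extChartAt (𝓡 m) p p)).toLinearMap
  have hdd : ∀ x, d' (d x) = x := mfderiv_extChartAt_symm_apply_apply p
  have hmet : ∀ u v, metricInChart g₂ p (extChartAt (𝓡 m) p p) u v = g₂.inner p (d' u) (d' v) :=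
    metricInChart_self g₂ p
  have hcurv : ∀ (g : RiemMetric m M) (x y z : TangentSpace (𝓡 m) p), curvature g p x y z
      = d' (chartCurvature (metricInChart g p) (extChartAt (𝓡 m) p p) (d x) (d y) (d z)) :=
    fun _ _ _ _ => rfl
  refine ⟨d' ∘ₗ schoutenChange (metricInChart g₂ p) f (extChartAt (𝓡 m) p p) ∘ₗ d,
    fun x y z => ?_⟩
  rw [hcurv, hcurv, hexp, key]
  simp only [map_add, map_sub, map_smul, hmet, hdd, LinearMap.comp_apply]

/-- The Weyl conformal curvature operator is a conformal invariant. -/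
theorem weyl_conformal (hm : 3 ≤ m) {g₁ g₂ : RiemMetric m M} (h : ConformallyEquivalent g₁ g₂)
    (p : M) (x y z : TangentSpace (𝓡 m) p) : weyl g₁ p x y z = weyl g₂ p x y z := by
  obtain ⟨α, hα, hpos, hg⟩ := h
  obtain ⟨A, hA⟩ := exists_curvature_eq hα hpos hg p
  exact weyl_eq_of_curvature hm (hg p) hA x y z

theorem ConformallyEquivalent.symm {g₁ g₂ : RiemMetric m M} (h : ConformallyEquivalent g₁ g₂) :
    ConformallyEquivalent g₂ g₁ := by
  obtain ⟨α, hα, hpos, hg⟩ := h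
  refine ⟨fun p => (α p)⁻¹, hα.inv₀ fun p => (hpos p).ne', fun p => inv_pos.2 (hpos p),
    fun p x y => ?_⟩
  rw [hg, inv_mul_cancel_left₀ (hpos p).ne']

/-! ### Rescaling of unit vectors and spectra. -/

theorem conformalJacobi_smul (g : RiemMetric m M) (p : M) (c : ℝ) (x : TangentSpace (𝓡 m) p) :
    conformalJacobi g p (c • x) = c ^ 2 • conformalJacobi g p x := by
  ext y
  change weyl g p y (c • x) (c • x) = c ^ 2 • weyl g p y x x
  simp only [weyl, tensorR0, tensorL, map_smul, LinearMap.smul_apply, smul_apply, smul_eq_mul]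
  module

theorem eigenspace_smul {V : Type*} [AddCommGroup V] [Module ℝ V] (T : Module.End ℝ V) {c : ℝ}
    (hc : c ≠ 0) (μ : ℝ) : (c • T).eigenspace (c * μ) = T.eigenspace μ := by
  ext x
  rw [Module.End.mem_eigenspace_iff, Module.End.mem_eigenspace_iff, LinearMap.smul_apply, mul_smul]
  exact smul_right_inj hc

theorem IsConformallyOsserman.of_conformallyEquivalent (hm : 3 ≤ m) {g₁ g₂ : RiemMetric m M}
    (h : ConformallyEquivalent g₁ g₂) (h₁ : IsConformallyOsserman g₁) :
    IsConformallyOsserman g₂ := by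
  have hW := weyl_conformal hm h
  obtain ⟨α, -, hpos, hg⟩ := h
  intro p x y hx hy μ
  have hα := hpos p
  -- Multiplication by `c` takes `g₂`-unit vectors to `g₁`-unit vectors and turns an eigenvalue `μ`
  -- into `c ^ 2 * μ`.
  set c := (√(α p))⁻¹ with hc
  have hc0 : c ≠ 0 := by positivity
  have hc2 : α p * (c * c) = 1 := by
    rw [hc, ← mul_inv, Real.mul_self_sqrt hα.le, mul_inv_cancel₀ hα.ne']
  have hunit : ∀ x : TangentSpace (𝓡 m) p, g₂.inner p x x = 1 →
      g₁.inner p (c • x) (c • x) = 1 := by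
    intro x hx
    simp only [hg, map_smul, smul_apply, smul_eq_mul, hx]
    linarith
  have hJ : ∀ x : TangentSpace (𝓡 m) p,
      (conformalJacobi g₁ p (c • x)).eigenspace (c ^ 2 * μ)
        = (conformalJacobi g₂ p x).eigenspace μ := by
    intro x
    have : conformalJacobi g₁ p x = conformalJacobi g₂ p x := LinearMap.ext fun y => hW p y x x
    rw [conformalJacobi_smul, eigenspace_smul _ (pow_ne_zero 2 hc0), this]
  rw [← hJ, ← hJ]
  exact h₁ p _ _ (hunit x hx) (hunit y hy) _

end Manifold
end ConformalGeometry
end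

theorem theorem1p2 {m : ℕ} (hm : 3 ≤ m) {M : Type*} [TopologicalSpace M]
    [ChartedSpace (EuclideanSpace ℝ (Fin m)) M] [IsManifold (𝓡 m) ∞ M]
    (g₁ g₂ : ConformalGeometry.RiemMetric m M)
    (h : ConformalGeometry.ConformallyEquivalent g₁ g₂) :
    ConformalGeometry.IsConformallyOsserman g₁ ↔ ConformalGeometry.IsConformallyOsserman g₂ :=
  ⟨ConformalGeometry.IsConformallyOsserman.of_conformallyEquivalent hm h,
    ConformalGeometry.IsConformallyOsserman.of_conformallyEquivalent hm h.symm⟩
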